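/- Let $r,c,\lambda,\varepsilon,\sigma>0$, $\mu>r$, $w_s:=c/r$, $b<w_s$, and $R:=\frac12\left(\frac{\mu-r}{\sigma}\right)^2$. For $w,u,p,q\in\mathbb R$ put $$F(w,u,p,q):=\lambda u-\inf_{\pi\in\mathbb R}\left\{\tfrac12\sigma^2(\varepsilon p^2+q)\pi^2+(\mu-r)p\pi+(rw-c)p\right\}\in(-\infty,\infty].$$ Let $\hat u:[b,w_s]\to[0,\infty)$ be a continuous viscosity solution of $F(w,u,u',u'')=0$ in $(b,w_s)$ with $u(b)=1$ and $u(w_s)=0$; that is, $\hat u$ has these boundary values, and for all $\varphi\in C^2(b,w_s)$ and $w_0\in(b,w_s)$ one has $F(w_0,\hat u(w_0),\varphi'(w_0),\varphi''(w_0))\le 0$ if $\hat u-\varphi$ has a local maximum at $w_0$, and $F(w_0,\hat u(w_0),\varphi'(w_0),\varphi''(w_0))\ge 0$ if $\hat u-\varphi$ has a local minimum at $w_0$. Let $\hat v:=e^{\varepsilon\hat u}$. Then the following hold, where derivatives at $b$ are one-sided. 1. $\hat v$ is strictly convex and strictly decreasing on $[b,w_s]$, $\hat v\in C^1[b,w_s]\cap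 C^2[b,w_s)$, and in fact $\hat v\in C^\infty[b,w_s)$. Moreover $\hat v'<0$ and $\hat v''>0$ on $[b,w_s)$, and $$\lambda \hat v\ln \hat v=-R\frac{(\hat v')^2}{\hat v''}+(rw-c)\hat v',\qquad w\in(b,w_s).$$ 2. $\hat u\in C^1[b,w_s]\cap C^2[b,w_s)$, $\hat u'<0$ and $\varepsilon(\hat u')^2+\hat u''>0$ on $[b,w_s)$, and $$\lambda \hat u=-R\frac{(\hat u')^2}{\varepsilon(\hat u')^2+\hat u''}+(rw-c)\hat u',\qquad w\in(b,w_s).$$ -/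

import Mathlib

open Set
open scoped ContDiff

noncomputable section

/-- The constant `R`, half the squared Sharpe ratio. -/
def sharpeConst (r μ σ : ℝ) : ℝ := (1 / 2) * ((μ - r) / σ) ^ 2

/-- The Hamilton-Jacobi-Bellman operator `F(w, u, u', u'')`, with `p` in place of `u'` and `q` in
place of `u''`. The infimum over the controls `π` may be `-∞`, so `F` takes values in `(-∞, ∞]`. -/
def hjbOperator (r μ σ c lam ε : ℝ) (w u p q : ℝ) : EReal :=
  ((lam * u : ℝ) : EReal) -
    ⨅ π : ℝ, (((1 / 2) * σ ^ 2 * (ε * p ^ 2 + q) * π ^ 2 + (μ - r) * p * π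
      + (r * w - c) * p : ℝ) : EReal)

/-- `u` is an upper semicontinuous viscosity subsolution of `H(w, u, u', u'') = 0` in the open
interval `(x, y)`. -/
def IsViscositySubsolution (H : ℝ → ℝ → ℝ → ℝ → EReal) (x y : ℝ) (u : ℝ → ℝ) : Prop :=
  UpperSemicontinuousOn u (Ioo x y) ∧
    ∀ φ : ℝ → ℝ, ContDiffOn ℝ 2 φ (Ioo x y) → ∀ w ∈ Ioo x y,
      IsLocalMax (fun z => u z - φ z) w → H w (u w) (deriv φ w) (deriv (deriv φ) w) ≤ 0

/-- `u` is a lower semicontinuous viscosity supersolution of `H(w, u, u', u'') = 0` in the open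
interval `(x, y)`. -/
def IsViscositySupersolution (H : ℝ → ℝ → ℝ → ℝ → EReal) (x y : ℝ) (u : ℝ → ℝ) : Prop :=
  LowerSemicontinuousOn u (Ioo x y) ∧
    ∀ φ : ℝ → ℝ, ContDiffOn ℝ 2 φ (Ioo x y) → ∀ w ∈ Ioo x y,
      IsLocalMin (fun z => u z - φ z) w → 0 ≤ H w (u w) (deriv φ w) (deriv (deriv φ) w)

/-- `u` is a continuous nonnegative viscosity solution on `[b, c / r]` of the Dirichlet problem
`F(w, u, u', u'') = 0` in `(b, c / r)`, `u(b) = 1`, `u(c / r) = 0`. Only the values of `u` on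
`[b, c / r]` matter. -/
structure IsRobustRuinViscositySolution (r μ σ c lam ε b : ℝ) (u : ℝ → ℝ) : Prop where
  continuousOn : ContinuousOn u (Icc b (c / r))
  nonneg : ∀ w ∈ Icc b (c / r), 0 ≤ u w
  subsolution : IsViscositySubsolution (hjbOperator r μ σ c lam ε) b (c / r) u
  supersolution : IsViscositySupersolution (hjbOperator r μ σ c lam ε) b (c / r) u
  left_boundary : u b = 1
  right_boundary : u (c / r) = 0

/-- The Cole-Hopf transform `v = exp (ε u)`. -/
def coleHopf (ε : ℝ) (u : ℝ → ℝ) : ℝ → ℝ := fun w => Real.exp (ε * u w)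

end

open Filter Topology

/-! ### Touching parabolas, convexity and monotone derivatives -/

/-- `v` lies locally below the parabola through `(w₀, v w₀)` with slope `p` and curvature `q`. -/
def TouchedAbove (v : ℝ → ℝ) (w₀ p q : ℝ) : Prop :=
  ∀ᶠ w in 𝓝 w₀, v w ≤ v w₀ + p * (w - w₀) + q / 2 * (w - w₀) ^ 2

/-- `v` lies locally above the parabola through `(w₀, v w₀)` with slope `p` and curvature `q`. -/
def TouchedBelow (v : ℝ → ℝ) (w₀ p q : ℝ) : Prop :=
  ∀ᶠ w in 𝓝 w₀, v w₀ + p * (w - w₀) + q / 2 * (w - w₀) ^ 2 ≤ v w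

theorem TouchedAbove.neg {v : ℝ → ℝ} {w₀ p q : ℝ} (h : TouchedAbove (fun w => -v w) w₀ p q) :
    TouchedBelow v w₀ (-p) (-q) := by
  filter_upwards [h] with w hw
  linarith

theorem exists_touchedAbove {f : ℝ → ℝ} {x y m β κ : ℝ} (hf : ContinuousOn f (Icc x y))
    (hm : m ∈ Ioo x y) (hx : f x - (β * x + κ / 2 * x ^ 2) < f m - (β * m + κ / 2 * m ^ 2))
    (hy : f y - (β * y + κ / 2 * y ^ 2) < f m - (β * m + κ / 2 * m ^ 2)) :
    ∃ w₀ ∈ Ioo x y, TouchedAbove f w₀ (β + κ * w₀) κ := by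
  have hc : ContinuousOn (fun w => f w - (β * w + κ / 2 * w ^ 2)) (Icc x y) :=
    hf.sub (by fun_prop)
  obtain ⟨w₀, hw₀, hmax⟩ := isCompact_Icc.exists_isMaxOn ⟨m, Ioo_subset_Icc_self hm⟩ hc
  have hm' := hmax (Ioo_subset_Icc_self hm)
  simp only [mem_ofPred_eq] at hm'
  have h1 : w₀ ≠ x := by rintro rfl; linarith
  have h2 : w₀ ≠ y := by rintro rfl; linarith
  have hw : w₀ ∈ Ioo x y := ⟨lt_of_le_of_ne hw₀.1 h1.symm, lt_of_le_of_ne hw₀.2 h2⟩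
  refine ⟨w₀, hw, ?_⟩
  filter_upwards [Icc_mem_nhds hw.1 hw.2] with w hw
  have := hmax hw
  simp only [mem_ofPred_eq] at this
  nlinarith

/-- If the graph of `f - M/2 w²` rose above a chord, subtracting the chord and a small concave bump
would leave an interior maximum, where `f` is touched from above with curvature below `M`. -/
theorem convexOn_sub_sq_of_touchedAbove {f : ℝ → ℝ} {x y M : ℝ} (hf : ContinuousOn f (Icc x y))
    (h : ∀ w ∈ Ioo x y, ∀ p q, TouchedAbove f w p q → M ≤ q) :
    ConvexOn ℝ (Icc x y) (fun w => f w - M / 2 * w ^ 2) := by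
  refine LinearOrder.convexOn_of_lt (convex_Icc x y) ?_
  intro x₁ h₁ x₂ h₂ h12 s t hs ht hst
  by_contra! hcon
  simp only [smul_eq_mul] at hcon
  set m := s * x₁ + t * x₂ with hm
  have ht' : s = 1 - t := by linarith
  have hm1 : m - x₁ = t * (x₂ - x₁) := by rw [hm, ht']; ring
  have hm2 : x₂ - m = s * (x₂ - x₁) := by
    rw [hm, show t = 1 - s by linarith]; ring
  have hd : 0 < x₂ - x₁ := by linarith
  have hmm : m ∈ Ioo x₁ x₂ := ⟨by nlinarith [mul_pos ht hd], by nlinarith [mul_pos hs hd]⟩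
  set g : ℝ → ℝ := fun w => f w - M / 2 * w ^ 2 with hg
  set β := (g x₂ - g x₁) / (x₂ - x₁) with hβ
  have hβ' : β * (x₂ - x₁) = g x₂ - g x₁ := by rw [hβ]; field_simp
  have hgap : 0 < g m - (s * g x₁ + t * g x₂) := by simp only [hg]; linarith
  have hP : 0 < (m - x₁) * (x₂ - m) :=
    mul_pos (by linarith [hmm.1]) (by linarith [hmm.2])
  -- The bump `δ (w - x₁) (x₂ - w)` vanishes at both ends and uses up half of the gap at `m`;
  -- subtracting it lowers the curvature of the touching parabola to `M - 2 δ`.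
  set δ := (g m - (s * g x₁ + t * g x₂)) / (2 * ((m - x₁) * (x₂ - m))) with hδ
  have hδ0 : 0 < δ := by positivity
  have hδ' : δ * ((m - x₁) * (x₂ - m)) = (g m - (s * g x₁ + t * g x₂)) / 2 := by
    rw [hδ, div_mul_eq_mul_div, mul_div_mul_right _ _ hP.ne']
  have e1 : g x₁ = g m - (g m - (s * g x₁ + t * g x₂)) - β * (m - x₁) := by
    rw [hm1]
    have : β * (t * (x₂ - x₁)) = t * (g x₂ - g x₁) := by rw [← hβ']; ring
    rw [this, ht']; ring
  have e2 : g x₂ = g m - (g m - (s * g x₁ + t * g x₂)) + β * (x₂ - m) := by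
    rw [hm2]
    have : β * (s * (x₂ - x₁)) = s * (g x₂ - g x₁) := by rw [← hβ']; ring
    rw [this, show t = 1 - s by linarith]; ring
  have f1 : ∀ w, f w = g w + M / 2 * w ^ 2 := fun w => by simp [hg]
  obtain ⟨w₀, hw₀, hT⟩ := exists_touchedAbove (β := β + δ * (x₁ + x₂)) (κ := M - 2 * δ)
    (hf.mono (Icc_subset_Icc h₁.1 h₂.2)) hmm
    (by rw [f1 x₁, f1 m]; nlinarith) (by rw [f1 x₂, f1 m]; nlinarith)
  have := h w₀ ⟨by linarith [hw₀.1, h₁.1], by linarith [hw₀.2, h₂.2]⟩ _ _ hT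
  linarith

theorem exists_touchedAbove_Ioo {f : ℝ → ℝ} {x y : ℝ} (hxy : x < y)
    (hf : ContinuousOn f (Icc x y)) : ∃ w ∈ Ioo x y, ∃ p q, TouchedAbove f w p q := by
  set m := (x + y) / 2 with hm
  have hmm : m ∈ Ioo x y := ⟨by rw [hm]; linarith, by rw [hm]; linarith⟩
  -- Without touching parabolas the curvature bound holds vacuously for every `M`, and midpoint
  -- convexity of `f - M/2 w²` would bound all real `M`.
  by_contra! hcon
  have hconv : ∀ M : ℝ, ConvexOn ℝ (Icc x y) (fun w => f w - M / 2 * w ^ 2) := fun M =>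
    convexOn_sub_sq_of_touchedAbove hf fun w hw p q hT => absurd hT (hcon w hw p q)
  have h0 : 0 < (y - x) ^ 2 := by have := sub_pos.2 hxy; positivity
  have key : ∀ M : ℝ, M * (y - x) ^ 2 ≤ 8 * (f x / 2 + f y / 2 - f m) := by
    intro M
    have := (hconv M).2 (left_mem_Icc.2 hxy.le) (right_mem_Icc.2 hxy.le)
      (show (0 : ℝ) ≤ 1 / 2 by norm_num) (show (0 : ℝ) ≤ 1 / 2 by norm_num) (by norm_num)
    simp only [smul_eq_mul] at this
    rw [show 1 / 2 * x + 1 / 2 * y = m by rw [hm]; ring] at this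
    have e : M / 2 * m ^ 2 = M * (x + y) ^ 2 / 8 := by rw [hm]; ring
    rw [e] at this
    nlinarith
  have := key ((8 * (f x / 2 + f y / 2 - f m) + 1) / (y - x) ^ 2)
  rw [div_mul_cancel₀ _ h0.ne'] at this
  linarith

theorem deriv_sub_ge_of_touchedAbove {f P : ℝ → ℝ} {x y M : ℝ}
    (hP : ∀ w ∈ Ioo x y, HasDerivAt f (P w) w)
    (h : ∀ w ∈ Ioo x y, ∀ p q, TouchedAbove f w p q → M ≤ q)
    {w₁ w₂ : ℝ} (h₁ : w₁ ∈ Ioo x y) (h₂ : w₂ ∈ Ioo x y) (h12 : w₁ ≤ w₂) :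
    M * (w₂ - w₁) ≤ P w₂ - P w₁ := by
  have hsub : Icc w₁ w₂ ⊆ Ioo x y := fun z hz => ⟨h₁.1.trans_le hz.1, hz.2.trans_lt h₂.2⟩
  have hconv := convexOn_sub_sq_of_touchedAbove (M := M) (x := w₁) (y := w₂)
    (fun z hz => (hP z (hsub hz)).continuousAt.continuousWithinAt)
    (fun w hw => h w (hsub (Ioo_subset_Icc_self hw)))
  have hd : ∀ z ∈ Icc w₁ w₂, HasDerivAt (fun w => f w - M / 2 * w ^ 2) (P z - M * z) z := by
    intro z hz
    have := (hP z (hsub hz)).sub (((hasDerivAt_id z).pow 2).const_mul (M / 2))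
    refine this.congr_deriv ?_
    simp; ring
  have := hconv.monotoneOn_deriv (fun z hz => (hd z hz).differentiableAt)
    (left_mem_Icc.2 h12) (right_mem_Icc.2 h12) h12
  rw [(hd _ (left_mem_Icc.2 h12)).deriv, (hd _ (right_mem_Icc.2 h12)).deriv] at this
  linarith

theorem deriv_sub_le_of_touchedBelow {f P : ℝ → ℝ} {x y M : ℝ}
    (hP : ∀ w ∈ Ioo x y, HasDerivAt f (P w) w)
    (h : ∀ w ∈ Ioo x y, ∀ p q, TouchedBelow f w p q → q ≤ M)
    {w₁ w₂ : ℝ} (h₁ : w₁ ∈ Ioo x y) (h₂ : w₂ ∈ Ioo x y) (h12 : w₁ ≤ w₂) :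
    P w₂ - P w₁ ≤ M * (w₂ - w₁) := by
  have := deriv_sub_ge_of_touchedAbove (f := fun w => -f w) (P := fun w => -P w) (M := -M)
    (fun w hw => (hP w hw).neg)
    (fun w hw p q hT => by linarith [h w hw _ _ hT.neg]) h₁ h₂ h12
  linarith

theorem TouchedAbove.eq_of_hasDerivAt {f : ℝ → ℝ} {w₀ p q p' : ℝ} (h : TouchedAbove f w₀ p q)
    (hd : HasDerivAt f p' w₀) : p = p' := by
  have hmax : IsLocalMax (fun w => f w - (p * (w - w₀) + q / 2 * (w - w₀) ^ 2)) w₀ := by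
    filter_upwards [h] with w hw
    simp only [sub_self]
    linarith
  have hd' := hd.sub ((((hasDerivAt_id w₀).sub_const w₀).const_mul p).add
    ((((hasDerivAt_id w₀).sub_const w₀).pow 2).const_mul (q / 2)))
  have := hmax.hasDerivAt_eq_zero hd'
  simp at this
  linarith

theorem TouchedBelow.eq_of_hasDerivAt {f : ℝ → ℝ} {w₀ p q p' : ℝ} (h : TouchedBelow f w₀ p q)
    (hd : HasDerivAt f p' w₀) : p = p' := by
  have h' : TouchedAbove (fun w => -f w) w₀ (-p) (-q) := by
    filter_upwards [h] with w hw
    linarith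
  linarith [h'.eq_of_hasDerivAt hd.neg]

theorem ConvexOn.monotoneOn_of_hasDerivAt {f P : ℝ → ℝ} {x y : ℝ}
    (hf : ConvexOn ℝ (Icc x y) f) (hP : ∀ w ∈ Ioo x y, HasDerivAt f (P w) w) :
    MonotoneOn P (Ioo x y) := by
  have := (hf.subset Ioo_subset_Icc_self (convex_Ioo x y)).monotoneOn_deriv
    (fun w hw => (hP w hw).differentiableAt)
  intro w hw z hz hwz
  simpa [(hP w hw).deriv, (hP z hz).deriv] using this hw hz hwz

/-- A monotone derivative has one-sided limits at each point. These limits are one-sided derivatives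
there, so both equal `P w`. -/
theorem ConvexOn.continuousOn_of_hasDerivAt {f P : ℝ → ℝ} {x y : ℝ}
    (hf : ConvexOn ℝ (Icc x y) f) (hP : ∀ w ∈ Ioo x y, HasDerivAt f (P w) w) :
    ContinuousOn P (Ioo x y) := by
  have hmono := hf.monotoneOn_of_hasDerivAt hP
  intro w hw
  apply ContinuousAt.continuousWithinAt
  rw [continuousAt_iff_continuous_left'_right']
  constructor
  · have hs : Ioo x w ⊆ Ioo x y := Ioo_subset_Ioo_right hw.2.le
    have hlim := (hmono.mono hs).tendsto_nhdsWithin_Ioo_left (nonempty_Ioo.2 hw.1)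
      ⟨P w, by rintro _ ⟨z, hz, rfl⟩; exact hmono (hs hz) hw hz.2.le⟩
    have hd : HasDerivWithinAt f _ (Iic w) w := hasDerivWithinAt_Iic_of_tendsto_deriv
      (s := Ioo x w) (fun z hz => (hP z (hs hz)).differentiableAt.differentiableWithinAt)
      (hP w hw).continuousAt.continuousWithinAt (Ioo_mem_nhdsLT hw.1)
      (hlim.congr' (by
        filter_upwards [Ioo_mem_nhdsLT hw.1] with z hz using (hP z (hs hz)).deriv.symm))
    have e := (uniqueDiffWithinAt_Iic w).eq_deriv _ (hP w hw).hasDerivWithinAt hd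
    rw [ContinuousWithinAt, e]
    exact hlim
  · have hs : Ioo w y ⊆ Ioo x y := Ioo_subset_Ioo_left hw.1.le
    have hlim := (hmono.mono hs).tendsto_nhdsWithin_Ioo_right (nonempty_Ioo.2 hw.2)
      ⟨P w, by rintro _ ⟨z, hz, rfl⟩; exact hmono hw (hs hz) hz.1.le⟩
    have hd : HasDerivWithinAt f _ (Ici w) w := hasDerivWithinAt_Ici_of_tendsto_deriv
      (s := Ioo w y) (fun z hz => (hP z (hs hz)).differentiableAt.differentiableWithinAt)
      (hP w hw).continuousAt.continuousWithinAt (Ioo_mem_nhdsGT hw.2)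
      (hlim.congr' (by
        filter_upwards [Ioo_mem_nhdsGT hw.2] with z hz using (hP z (hs hz)).deriv.symm))
    have e := (uniqueDiffWithinAt_Ici w).eq_deriv _ (hP w hw).hasDerivWithinAt hd
    rw [ContinuousWithinAt, e]
    exact hlim

/-- A function with `P' ≤ -K P` cannot decay faster than exponentially. -/
theorem antitoneOn_mul_exp {P P' : ℝ → ℝ} {K : ℝ} {s : Set ℝ} (hs : Convex ℝ s)
    (hc : ContinuousOn P s) (hP : ∀ w ∈ interior s, HasDerivAt P (P' w) w)
    (h : ∀ w ∈ interior s, P' w ≤ -K * P w) :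
    AntitoneOn (fun w => P w * Real.exp (K * w)) s := by
  have hd : ∀ w ∈ interior s, HasDerivAt (fun w => P w * Real.exp (K * w))
      ((P' w + K * P w) * Real.exp (K * w)) w := by
    intro w hw
    refine ((hP w hw).mul (((hasDerivAt_id w).const_mul K).exp)).congr_deriv ?_
    simp; ring
  refine antitoneOn_of_deriv_nonpos hs (hc.mul (by fun_prop))
    (fun w hw => (hd w hw).differentiableAt.differentiableWithinAt) fun w hw => ?_
  rw [(hd w hw).deriv]
  exact mul_nonpos_of_nonpos_of_nonneg (by linarith [h w hw]) (Real.exp_pos _).le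

/-! ### The operator and the Cole-Hopf transform -/

theorem le_of_hjbOperator_nonpos {r μ σ c lam ε w u p q : ℝ}
    (h : hjbOperator r μ σ c lam ε w u p q ≤ 0) (π : ℝ) :
    lam * u ≤ (1 / 2) * σ ^ 2 * (ε * p ^ 2 + q) * π ^ 2 + (μ - r) * p * π + (r * w - c) * p := by
  have := (EReal.sub_nonpos.1 h).trans (iInf_le _ π)
  exact EReal.coe_le_coe_iff.1 this

/-- The margin `δ` is needed because the infimum over `π` need not be attained and may be `-∞`. -/
theorem exists_lt_of_hjbOperator_nonneg {r μ σ c lam ε w u p q : ℝ}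
    (h : 0 ≤ hjbOperator r μ σ c lam ε w u p q) {δ : ℝ} (hδ : 0 < δ) :
    ∃ π : ℝ, (1 / 2) * σ ^ 2 * (ε * p ^ 2 + q) * π ^ 2 + (μ - r) * p * π + (r * w - c) * p
      < lam * u + δ := by
  have h1 := (EReal.sub_nonneg (Or.inl (EReal.coe_ne_top _)) (Or.inl (EReal.coe_ne_bot _))).1 h
  have h2 : ((lam * u : ℝ) : EReal) < ((lam * u + δ : ℝ) : EReal) :=
    EReal.coe_lt_coe_iff.2 (by linarith)
  obtain ⟨π, hπ⟩ := iInf_lt_iff.1 (h1.trans_lt h2)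
  exact ⟨π, EReal.coe_lt_coe_iff.1 hπ⟩

/-- The germ of `log ψ / ε`, with `ψ` a parabola positive at `w₀`, extends to a smooth function. -/
theorem exists_contDiff_log_parabola {ε v₀ w₀ : ℝ} (hε : 0 < ε) (hv : 0 < v₀) (p q : ℝ) :
    ∃ φ : ℝ → ℝ, ContDiff ℝ 2 φ ∧
      (φ =ᶠ[𝓝 w₀] fun w => Real.log (v₀ + p * (w - w₀) + q / 2 * (w - w₀) ^ 2) / ε) ∧
      deriv φ w₀ = p / (ε * v₀) ∧ deriv (deriv φ) w₀ = (q * v₀ - p ^ 2) / (ε * v₀ ^ 2) := by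
  set ψ : ℝ → ℝ := fun w => v₀ + p * (w - w₀) + q / 2 * (w - w₀) ^ 2 with hψ
  have hψc : ContDiff ℝ 2 ψ := by fun_prop
  have hψ0 : ψ w₀ = v₀ := by simp [hψ]
  have hpos : ∀ᶠ w in 𝓝 w₀, 0 < ψ w :=
    hψc.continuous.continuousAt.eventually (lt_mem_nhds (by rw [hψ0]; exact hv))
  obtain ⟨ρ, hρ, hball⟩ := Metric.eventually_nhds_iff_ball.1 hpos
  -- The parabola is positive only near `w₀`; blending it with the constant `v₀` by a bump keeps the
  -- argument of the logarithm positive everywhere.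
  let f : ContDiffBump w₀ := ⟨ρ / 2, ρ, by positivity, by linarith⟩
  have hf1 : ∀ᶠ w in 𝓝 w₀, f w = 1 := f.eventuallyEq_one
  have hχ : ∀ w, 0 < f w * ψ w + (1 - f w) * v₀ := by
    intro w
    by_cases hw : w ∈ Metric.ball w₀ ρ
    · have h1 := hball w hw
      have h2 : 0 < f w := f.pos_of_mem_ball hw
      have h3 : f w ≤ 1 := f.le_one
      have := mul_pos h2 h1
      have := mul_nonneg (sub_nonneg.2 h3) hv.le
      linarith
    · have : f w = 0 := f.zero_of_le_dist (by simpa using hw)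
      rw [this]; simpa using hv
  have hfc : ContDiff ℝ 2 f := f.contDiff
  have heq : (fun w => Real.log (f w * ψ w + (1 - f w) * v₀) / ε) =ᶠ[𝓝 w₀]
      fun w => Real.log (ψ w) / ε := by
    filter_upwards [hf1] with w hw
    simp [hw]
  have hψd : ∀ w, HasDerivAt ψ (p + q * (w - w₀)) w := by
    intro w
    refine (((((hasDerivAt_id w).sub_const w₀).const_mul p).const_add v₀).add
      ((((hasDerivAt_id w).sub_const w₀).pow 2).const_mul (q / 2))).congr_deriv ?_
    simp; ring
  have hd1 : ∀ᶠ w in 𝓝 w₀, deriv (fun w => Real.log (f w * ψ w + (1 - f w) * v₀) / ε) w =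
      (p + q * (w - w₀)) / ψ w / ε := by
    filter_upwards [heq.eventuallyEq_nhds, hpos] with w hw hw'
    rw [hw.deriv_eq]
    exact (((hψd w).log hw'.ne').div_const ε).deriv
  refine ⟨fun w => Real.log (f w * ψ w + (1 - f w) * v₀) / ε, ?_, heq, ?_, ?_⟩
  · exact (((hfc.mul hψc).add ((contDiff_const.sub hfc).mul contDiff_const)).log
      fun w => (hχ w).ne').div_const ε
  · rw [hd1.self_of_nhds, hψ0]
    field_simp; simp
  · have hd2 : HasDerivAt (fun w => (p + q * (w - w₀)) / ψ w / ε)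
        ((q * ψ w₀ - (p + q * (w₀ - w₀)) * (p + q * (w₀ - w₀))) / ψ w₀ ^ 2 / ε) w₀ := by
      refine HasDerivAt.div_const (HasDerivAt.div ?_ (hψd w₀) (by rw [hψ0]; exact hv.ne')) ε
      refine ((((hasDerivAt_id w₀).sub_const w₀).const_mul q).const_add p).congr_deriv ?_
      simp
    rw [EventuallyEq.deriv_eq hd1, hd2.deriv, hψ0]
    field_simp; simp

theorem eq_log_exp_mul_div {ε u : ℝ} (hε : 0 < ε) : u = Real.log (Real.exp (ε * u)) / ε := by
  rw [Real.log_exp]; field_simp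

/-- The subsolution property of `u` in terms of parabolas touching `exp (ε u)` from above. -/
theorem IsViscositySubsolution.le_of_touchedAbove {r μ σ c lam ε x y : ℝ} {u : ℝ → ℝ}
    (hε : 0 < ε) (h : IsViscositySubsolution (hjbOperator r μ σ c lam ε) x y u) {w₀ p q : ℝ}
    (hw : w₀ ∈ Ioo x y) (hT : TouchedAbove (coleHopf ε u) w₀ p q) (π : ℝ) :
    lam * (coleHopf ε u w₀ * Real.log (coleHopf ε u w₀)) ≤
      (1 / 2) * σ ^ 2 * q * π ^ 2 + (μ - r) * p * π + (r * w₀ - c) * p := by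
  set v := coleHopf ε u with hv
  have hvpos : ∀ w, 0 < v w := fun w => Real.exp_pos _
  have hlog : ∀ w, u w = Real.log (v w) / ε := fun w => eq_log_exp_mul_div hε
  obtain ⟨φ, hφ, he, h1, h2⟩ := exists_contDiff_log_parabola (w₀ := w₀) hε (hvpos w₀) p q
  have hmax : IsLocalMax (fun z => u z - φ z) w₀ := by
    filter_upwards [hT, he] with w hw hw'
    have e0 := he.self_of_nhds
    simp only [sub_self, mul_zero, add_zero, ne_eq, OfNat.ofNat_ne_zero, not_false_eq_true,
      zero_pow] at e0
    rw [hw', e0, hlog w, hlog w₀]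
    have := Real.log_le_log (hvpos w) hw
    have := div_le_div_of_nonneg_right this hε.le
    linarith
  have key := le_of_hjbOperator_nonpos (h.2 φ hφ.contDiffOn w₀ hw hmax) π
  rw [h1, h2] at key
  have hp := mul_pos hε (hvpos w₀)
  -- Here `ε φ'² + φ'' = q / (ε v)` and `φ' = p / (ε v)` at `w₀`, so the factor `ε v` makes the
  -- inequality linear in `p` and `q`.
  have key2 := mul_le_mul_of_nonneg_left key hp.le
  have hne := (hvpos w₀).ne'
  calc lam * (v w₀ * Real.log (v w₀)) = ε * v w₀ * (lam * u w₀) := by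
        rw [hlog w₀]; field_simp
    _ ≤ _ := key2
    _ = _ := by field_simp; ring

/-- The supersolution property of `u` in terms of parabolas touching `exp (ε u)` from below. -/
theorem IsViscositySupersolution.exists_lt_of_touchedBelow {r μ σ c lam ε x y : ℝ} {u : ℝ → ℝ}
    (hε : 0 < ε) (h : IsViscositySupersolution (hjbOperator r μ σ c lam ε) x y u) {w₀ p q : ℝ}
    (hw : w₀ ∈ Ioo x y) (hT : TouchedBelow (coleHopf ε u) w₀ p q) {δ : ℝ} (hδ : 0 < δ) :
    ∃ π : ℝ, (1 / 2) * σ ^ 2 * q * π ^ 2 + (μ - r) * p * π + (r * w₀ - c) * p <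
      lam * (coleHopf ε u w₀ * Real.log (coleHopf ε u w₀)) + δ := by
  set v := coleHopf ε u with hv
  have hvpos : ∀ w, 0 < v w := fun w => Real.exp_pos _
  have hlog : ∀ w, u w = Real.log (v w) / ε := fun w => eq_log_exp_mul_div hε
  obtain ⟨φ, hφ, he, h1, h2⟩ := exists_contDiff_log_parabola (w₀ := w₀) hε (hvpos w₀) p q
  have hpos : ∀ᶠ w in 𝓝 w₀, 0 < v w₀ + p * (w - w₀) + q / 2 * (w - w₀) ^ 2 := by
    have hc : ContinuousAt (fun w => v w₀ + p * (w - w₀) + q / 2 * (w - w₀) ^ 2) w₀ := by fun_prop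
    exact hc.eventually (lt_mem_nhds (by simpa using hvpos w₀))
  have hmin : IsLocalMin (fun z => u z - φ z) w₀ := by
    filter_upwards [hT, he, hpos] with w hw hw' hw''
    have e0 := he.self_of_nhds
    simp only [sub_self, mul_zero, add_zero, ne_eq, OfNat.ofNat_ne_zero, not_false_eq_true,
      zero_pow] at e0
    rw [hw', e0, hlog w, hlog w₀]
    have := Real.log_le_log hw'' hw
    have := div_le_div_of_nonneg_right this hε.le
    linarith
  have hp := mul_pos hε (hvpos w₀)
  obtain ⟨π, key⟩ := exists_lt_of_hjbOperator_nonneg (h.2 φ hφ.contDiffOn w₀ hw hmin)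
    (div_pos hδ hp)
  rw [h1, h2] at key
  have key2 := mul_lt_mul_of_pos_left key hp
  have hne := (hvpos w₀).ne'
  refine ⟨π, ?_⟩
  calc _ = _ := by field_simp; ring
    _ < _ := key2
    _ = lam * (v w₀ * Real.log (v w₀)) + δ := by rw [hlog w₀]; field_simp

/-! ### The transformed equation -/

/-- The residual drift `(r w - c) p - lam v log v`, to be balanced by `R p² / q`. -/
noncomputable def slack (lam r c : ℝ) (v : ℝ → ℝ) (p w : ℝ) : ℝ :=
  (r * w - c) * p - lam * (v w * Real.log (v w))

/-- Viscosity solutions of `lam v log v = -R v'² / v'' + (r w - c) v'`, tested by parabolas. -/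
structure IsParabolaSolution (R lam r c b s : ℝ) (v : ℝ → ℝ) : Prop where
  R_pos : 0 < R
  lam_pos : 0 < lam
  lt : b < s
  drift_neg : ∀ w ∈ Ico b s, r * w - c < 0
  continuousOn : ContinuousOn v (Icc b s)
  one_le : ∀ w ∈ Icc b s, 1 ≤ v w
  one_lt_left : 1 < v b
  right : v s = 1
  above : ∀ w ∈ Ioo b s, ∀ p q, TouchedAbove v w p q →
    0 ≤ q ∧ 0 ≤ slack lam r c v p w ∧ R * p ^ 2 ≤ q * slack lam r c v p w
  below : ∀ w ∈ Ioo b s, ∀ p q, TouchedBelow v w p q → 0 < q →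
    q * slack lam r c v p w ≤ R * p ^ 2

theorem nonneg_of_quadratic_nonneg {a k d : ℝ} (h : ∀ x : ℝ, 0 ≤ a * (x * x) + k * x + d) :
    0 ≤ a ∧ 0 ≤ d ∧ k ^ 2 ≤ 4 * a * d := by
  have hd : 0 ≤ d := by simpa using h 0
  have hdis := discrim_le_zero h
  rw [discrim] at hdis
  refine ⟨?_, hd, by linarith⟩
  by_contra! ha
  have hk : k = 0 := by
    have : a * d ≤ 0 := mul_nonpos_of_nonpos_of_nonneg ha.le hd
    have : k ^ 2 = 0 := le_antisymm (by linarith) (sq_nonneg k)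
    simpa using this
  -- For `a < 0` and `k = 0`, this point satisfies `x ≥ 1` and `a x < -(d + 1)`, so `a x² + d < 0`.
  have := h ((d + 1) / -a + 1)
  subst hk
  have e : a * ((d + 1) / -a) = -(d + 1) := by
    rw [div_neg, mul_neg, mul_div_cancel₀ _ ha.ne]
  have hx : 0 ≤ (d + 1) / -a := by
    have : 0 < -a := by linarith
    positivity
  nlinarith

/-- Everything rests on a quadratic in `π`. From above it is nonnegative, which fixes the signs of
its coefficients and its discriminant. From below, `q > 0` is required because for `q < 0` the
infimum is `-∞` and gives no information; completing the square yields the minimum `-R p² / q` of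
the control terms. -/
theorem IsRobustRuinViscositySolution.isParabolaSolution {r μ σ c lam ε b : ℝ}
    (hr : 0 < r) (hμ : r < μ) (hσ : 0 < σ) (hlam : 0 < lam) (hε : 0 < ε)
    (hb : b < c / r) {u : ℝ → ℝ} (hu : IsRobustRuinViscositySolution r μ σ c lam ε b u) :
    IsParabolaSolution (sharpeConst r μ σ) lam r c b (c / r) (coleHopf ε u) where
  R_pos := by
    have : 0 < μ - r := by linarith
    unfold sharpeConst; positivity
  lam_pos := hlam
  lt := hb
  drift_neg w hw := by
    have := (lt_div_iff₀ hr).1 hw.2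
    linarith
  continuousOn := (hu.continuousOn.const_smul ε).rexp
  one_le w hw := Real.one_le_exp (mul_nonneg hε.le (hu.nonneg w hw))
  one_lt_left := by
    rw [coleHopf, hu.left_boundary]
    exact Real.one_lt_exp_iff.2 (by simpa using hε)
  right := by simp [coleHopf, hu.right_boundary]
  above w hw p q hT := by
    have h := fun π => hu.subsolution.le_of_touchedAbove hε hw hT π
    obtain ⟨h1, h2, h3⟩ := nonneg_of_quadratic_nonneg (a := 1 / 2 * σ ^ 2 * q) (k := (μ - r) * p)
      (d := slack lam r c (coleHopf ε u) p w) (fun x => by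
        have := h x
        rw [slack]; nlinarith)
    have hσ2 : 0 < σ ^ 2 := by positivity
    refine ⟨by nlinarith, h2, ?_⟩
    have : sharpeConst r μ σ * p ^ 2 = ((μ - r) * p) ^ 2 / (2 * σ ^ 2) := by
      unfold sharpeConst; field_simp
    rw [this, div_le_iff₀ (by positivity)]
    linarith
  below w hw p q hT hq := by
    have e : sharpeConst r μ σ * p ^ 2 = ((μ - r) * p) ^ 2 / (2 * σ ^ 2) := by
      unfold sharpeConst; field_simp
    rw [e]
    suffices h : slack lam r c (coleHopf ε u) p w ≤ ((μ - r) * p) ^ 2 / (2 * σ ^ 2 * q) by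
      have := mul_le_mul_of_nonneg_left h hq.le
      refine this.trans_eq ?_
      field_simp
    refine le_of_forall_pos_lt_add fun δ hδ => ?_
    obtain ⟨π, hπ⟩ := hu.supersolution.exists_lt_of_touchedBelow hε hw hT hδ
    have hsq : 0 ≤ (1 / 2 * σ ^ 2 * q) * (π + (μ - r) * p / (σ ^ 2 * q)) ^ 2 := by positivity
    have e2 : (1 / 2 * σ ^ 2 * q) * (π + (μ - r) * p / (σ ^ 2 * q)) ^ 2 =
        1 / 2 * σ ^ 2 * q * π ^ 2 + (μ - r) * p * π + ((μ - r) * p) ^ 2 / (2 * σ ^ 2 * q) := by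
      field_simp; ring
    rw [e2] at hsq
    rw [slack]
    linarith

/-! ### Interior regularity and bounds for `v` -/

namespace IsParabolaSolution

variable {R lam r c b s : ℝ} {v P : ℝ → ℝ}

theorem convexOn (h : IsParabolaSolution R lam r c b s v) : ConvexOn ℝ (Icc b s) v := by
  simpa using convexOn_sub_sq_of_touchedAbove (M := 0) h.continuousOn
    fun w hw p q hT => (h.above w hw p q hT).1

theorem continuousOn_mul_log (h : IsParabolaSolution R lam r c b s v) :
    ContinuousOn (fun w => v w * Real.log (v w)) (Icc b s) :=
  h.continuousOn.mul (h.continuousOn.log fun w hw => (zero_lt_one.trans_le (h.one_le w hw)).ne')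

theorem le_left (h : IsParabolaSolution R lam r c b s v) {w : ℝ} (hw : w ∈ Icc b s) :
    v w ≤ v b := by
  have := h.convexOn.le_max_of_mem_Icc (left_mem_Icc.2 h.lt.le) (right_mem_Icc.2 h.lt.le) hw
  rwa [h.right, max_eq_left h.one_lt_left.le] at this

theorem mul_log_nonneg (h : IsParabolaSolution R lam r c b s v) {w : ℝ} (hw : w ∈ Icc b s) :
    0 ≤ v w * Real.log (v w) :=
  mul_nonneg (zero_le_one.trans (h.one_le w hw)) (Real.log_nonneg (h.one_le w hw))

/-- This linear bound controls the zeroth-order term by `v - 1`, and thus by `-v'` through tangent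
lines, in the Gronwall argument of `one_lt`. -/
theorem mul_log_le (h : IsParabolaSolution R lam r c b s v) {w : ℝ} (hw : w ∈ Icc b s) :
    v w * Real.log (v w) ≤ v b * (v w - 1) := by
  have h1 := h.one_le w hw
  exact mul_le_mul (h.le_left hw) (Real.log_le_sub_one_of_pos (by linarith)) (Real.log_nonneg h1)
    (zero_le_one.trans h.one_lt_left.le)

/-- Subgradients from the right have nonnegative slack. -/
theorem slack_nonneg_of_subgradient (h : IsParabolaSolution R lam r c b s v) {w₀ p : ℝ}
    (hw₀ : w₀ ∈ Ioo b s) (hp : ∀ w ∈ Ioo w₀ s, v w₀ + p * (w - w₀) ≤ v w) :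
    0 ≤ slack lam r c v p w₀ := by
  have hcont : ContinuousWithinAt (slack lam r c v p) (Ioi w₀) w₀ := by
    have : ContinuousAt (slack lam r c v p) w₀ := by
      have h1 : ContinuousAt (fun w => (r * w - c) * p) w₀ := by fun_prop
      exact h1.sub ((h.continuousOn_mul_log.continuousAt (Icc_mem_nhds hw₀.1 hw₀.2)).const_mul lam)
    exact this.continuousWithinAt
  -- Negative slack at slope `p` persists slightly to the right. Some point there is touched from
  -- above, with a slope `p' ≥ p` by convexity; as the drift is negative, the slack at `p'` is
  -- negative too, against `above`.
  by_contra! hneg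
  have hev := hcont.eventually (gt_mem_nhds hneg)
  obtain ⟨y, hy, hsub⟩ := (mem_nhdsGT_iff_exists_Ioo_subset' hw₀.2).1
    (inter_mem hev (Ioo_mem_nhdsGT hw₀.2))
  have hy' : w₀ < y := hy
  set y' := min y s with hyd
  have hwy : w₀ < y' := lt_min hy' hw₀.2
  have hsubI : ∀ w ∈ Ioo w₀ y', w ∈ Ioo w₀ s := fun w hw => ⟨hw.1, hw.2.trans_le (min_le_right _ _)⟩
  obtain ⟨z, hz, p', q, hT⟩ := exists_touchedAbove_Ioo hwy
    (h.continuousOn.mono (Icc_subset_Icc hw₀.1.le (min_le_right _ _)))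
  have hzs := hsubI z hz
  have hzb : z ∈ Ioo b s := ⟨hw₀.1.trans hzs.1, hzs.2⟩
  have h1 := (h.above z hzb p' q hT).2.1
  have hs : slack lam r c v p z < 0 := (hsub ⟨hz.1, hz.2.trans_le (min_le_left _ _)⟩).1
  have hpp : p ≤ p' := by
    have hzi : z ∈ interior (Icc b s) := by rwa [interior_Icc]
    have hl := h.convexOn.slope_le_leftDeriv_of_mem_interior (Ioo_subset_Icc_self hw₀) hzi hzs.1
    rw [slope_def_field, div_le_iff₀ (sub_pos.2 hzs.1)] at hl
    have hld : derivWithin v (Iio z) z ≤ p' := by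
      have hr := h.convexOn.leftDeriv_le_rightDeriv_of_mem_interior hzi
      have hd2 := h.convexOn.hasDerivWithinAt_rightDeriv_of_mem_interior hzi
      rw [hasDerivWithinAt_iff_tendsto_slope' (by simp)] at hd2
      have hlim2 : Tendsto (fun w => p' + q / 2 * (w - z)) (𝓝[>] z) (𝓝 p') := by
        have : ContinuousAt (fun w => p' + q / 2 * (w - z)) z := by fun_prop
        simpa [ContinuousAt] using this.tendsto.mono_left (nhdsWithin_le_nhds (s := Ioi z))
      refine hr.trans (le_of_tendsto_of_tendsto hd2 hlim2 ?_)
      filter_upwards [nhdsWithin_le_nhds hT, self_mem_nhdsWithin] with w hw hw'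
      rw [slope_def_field, div_le_iff₀ (sub_pos.2 hw')]
      nlinarith
    have h3 := hp z hzs
    have hzw := sub_pos.2 hzs.1
    by_contra! hlt
    nlinarith [mul_lt_mul_of_pos_right (hld.trans_lt hlt) hzw]
  have hdr := h.drift_neg z ⟨hzb.1.le, hzb.2⟩
  have := mul_le_mul_of_nonpos_left hpp hdr.le
  simp only [slack] at h1 hs
  linarith

/-- At a kink the right slope has nonnegative slack, so the smaller midpoint slope has slack `D >
0`. A parabola with that slope and any curvature touches from below; curvature `(R p² + 1) / D`
violates `below`. -/
theorem differentiableAt (h : IsParabolaSolution R lam r c b s v) {w₀ : ℝ} (hw₀ : w₀ ∈ Ioo b s) :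
    DifferentiableAt ℝ v w₀ := by
  have hi : w₀ ∈ interior (Icc b s) := by rwa [interior_Icc]
  have hl := h.convexOn.hasDerivWithinAt_leftDeriv_of_mem_interior hi
  have hr := h.convexOn.hasDerivWithinAt_rightDeriv_of_mem_interior hi
  have hle := h.convexOn.leftDeriv_le_rightDeriv_of_mem_interior hi
  have hsl : ∀ w ∈ Icc b s, w < w₀ → v w₀ + derivWithin v (Iio w₀) w₀ * (w - w₀) ≤ v w := by
    intro w hw hlt
    have := h.convexOn.slope_le_leftDeriv_of_mem_interior hw hi hlt
    rw [slope_def_field, div_le_iff₀ (sub_pos.2 hlt)] at this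
    linarith
  have hsr : ∀ w ∈ Icc b s, w₀ < w → v w₀ + derivWithin v (Ioi w₀) w₀ * (w - w₀) ≤ v w := by
    intro w hw hlt
    have := h.convexOn.rightDeriv_le_slope_of_mem_interior hi hw hlt
    rw [slope_def_field, le_div_iff₀ (sub_pos.2 hlt)] at this
    linarith
  set pl := derivWithin v (Iio w₀) w₀
  set pr := derivWithin v (Ioi w₀) w₀
  rcases hle.eq_or_lt with he | hlt
  · rw [he] at hl
    have := hl.Iic_of_Iio.union hr.Ici_of_Ioi
    rw [Iic_union_Ici, hasDerivWithinAt_univ] at this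
    exact this.differentiableAt
  exfalso
  have hs0 := h.slack_nonneg_of_subgradient hw₀
    fun w hw => hsr w ⟨(hw₀.1.trans hw.1).le, hw.2.le⟩ hw.1
  set p := (pl + pr) / 2 with hp
  have hdr := h.drift_neg w₀ ⟨hw₀.1.le, hw₀.2⟩
  have hs1 : 0 < slack lam r c v p w₀ := by
    have : (r * w₀ - c) * pr < (r * w₀ - c) * p := mul_lt_mul_of_neg_left (by linarith) hdr
    simp only [slack] at hs0 ⊢
    linarith
  set D := slack lam r c v p w₀
  have hR := h.R_pos
  set q := (R * p ^ 2 + 1) / D with hq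
  have hq0 : 0 < q := by positivity
  have hT : TouchedBelow v w₀ p q := by
    have h1 : ∀ᶠ w in 𝓝 w₀, |q / 2 * (w - w₀)| < (pr - pl) / 2 := by
      have hc : ContinuousAt (fun w => |q / 2 * (w - w₀)|) w₀ := by fun_prop
      exact hc.eventually (gt_mem_nhds (by simpa using hlt))
    filter_upwards [h1, Icc_mem_nhds hw₀.1 hw₀.2] with w hw hwI
    rw [abs_lt] at hw
    rcases lt_trichotomy w w₀ with hww | rfl | hww
    · have := hsl w hwI hww
      nlinarith
    · simp
    · have := hsr w hwI hww
      nlinarith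
  have := h.below w₀ hw₀ p q hT hq0
  rw [hq, div_mul_cancel₀ _ hs1.ne'] at this
  linarith

theorem hasDerivAt (h : IsParabolaSolution R lam r c b s v) :
    ∀ w ∈ Ioo b s, HasDerivAt v (deriv v w) w :=
  fun _ hw => (h.differentiableAt hw).hasDerivAt

theorem tangent_le (h : IsParabolaSolution R lam r c b s v) {w z : ℝ} (hw : w ∈ Ioo b s)
    (hz : z ∈ Icc b s) : v w + deriv v w * (z - w) ≤ v z := by
  rcases lt_trichotomy z w with hlt | rfl | hlt
  · have := h.convexOn.slope_le_of_hasDerivAt hz (Ioo_subset_Icc_self hw) hlt (h.hasDerivAt w hw)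
    rw [slope_def_field, div_le_iff₀ (sub_pos.2 hlt)] at this
    linarith
  · simp
  · have := h.convexOn.le_slope_of_hasDerivAt (Ioo_subset_Icc_self hw) hz hlt (h.hasDerivAt w hw)
    rw [slope_def_field, le_div_iff₀ (sub_pos.2 hlt)] at this
    linarith

theorem slack_nonneg (h : IsParabolaSolution R lam r c b s v) {w : ℝ} (hw : w ∈ Ioo b s) :
    0 ≤ slack lam r c v (deriv v w) w :=
  h.slack_nonneg_of_subgradient hw
    fun _ hz => h.tangent_le hw ⟨(hw.1.trans hz.1).le, hz.2.le⟩

theorem continuousOn_deriv (h : IsParabolaSolution R lam r c b s v) :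
    ContinuousOn (deriv v) (Ioo b s) :=
  h.convexOn.continuousOn_of_hasDerivAt h.hasDerivAt

theorem monotoneOn_deriv (h : IsParabolaSolution R lam r c b s v) :
    MonotoneOn (deriv v) (Ioo b s) :=
  h.convexOn.monotoneOn_of_hasDerivAt h.hasDerivAt

theorem continuousOn_slack (h : IsParabolaSolution R lam r c b s v) {t : Set ℝ}
    (ht : t ⊆ Icc b s) (hP : ContinuousOn P t) :
    ContinuousOn (fun w => slack lam r c v (P w) w) t := by
  have h1 : ContinuousOn (fun w => r * w - c) t := by fun_prop
  exact (h1.mul hP).sub ((h.continuousOn_mul_log.mono ht).const_mul lam)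

/-- The slack vanishes nowhere: where it is small, `v''` is large, which makes it decrease. -/
theorem slack_pos (h : IsParabolaSolution R lam r c b s v) {w₀ : ℝ} (hw₀ : w₀ ∈ Ico b s)
    (hP : ContinuousOn P (Ico w₀ s)) (hd : ∀ w ∈ Ioo w₀ s, P w = deriv v w)
    (hv : 1 < v w₀) : 0 < slack lam r c v (P w₀) w₀ := by
  -- `P` is `v'` extended continuously to `w₀`, which admits `w₀ = b`, where the two-sided `deriv`
  -- is not the right notion.
  have hsubI : Ico w₀ s ⊆ Icc b s := fun w hw => ⟨hw₀.1.trans hw.1, hw.2.le⟩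
  have hsubO : Ioo w₀ s ⊆ Ioo b s := Ioo_subset_Ioo_left hw₀.1
  have hPd : ∀ w ∈ Ioo w₀ s, HasDerivAt v (P w) w := fun w hw => by
    rw [hd w hw]; exact h.hasDerivAt w (hsubO hw)
  have hself : w₀ ∈ Ico w₀ s := ⟨le_rfl, hw₀.2⟩
  have hne : 𝓝[Ioi w₀] w₀ ≤ 𝓝[Ico w₀ s] w₀ := by
    rw [← nhdsWithin_Ioo_eq_nhdsGT hw₀.2]
    exact nhdsWithin_mono _ Ioo_subset_Ico_self
  have hDc := h.continuousOn_slack hsubI hP w₀ hself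
  have hD0 : 0 ≤ slack lam r c v (P w₀) w₀ := by
    refine ge_of_tendsto (hDc.tendsto.mono_left hne) ?_
    filter_upwards [Ioo_mem_nhdsGT hw₀.2] with w hw
    rw [hd w hw]
    exact h.slack_nonneg (hsubO hw)
  have hA := h.drift_neg w₀ hw₀
  have hlogpos : 0 < v w₀ * Real.log (v w₀) := mul_pos (by linarith) (Real.log_pos hv)
  have hlam := h.lam_pos
  have hR := h.R_pos
  have hp0 : P w₀ < 0 := by
    have := mul_pos hlam hlogpos
    simp only [slack] at hD0
    by_contra! hcon
    nlinarith
  by_contra! hle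
  set p₀ := P w₀ with hp₀
  -- Chosen so that `(r w₀ - c) M` outweighs the other terms in the derivative of the slack by at
  -- least 1.
  set M := (|r * p₀ - lam * ((Real.log (v w₀) + 1) * p₀)| + 1) / (-(r * w₀ - c)) with hM
  have hA' : 0 < -(r * w₀ - c) := by linarith
  have hM0 : 0 < M := by positivity
  have hMA : (r * w₀ - c) * M = -(|r * p₀ - lam * ((Real.log (v w₀) + 1) * p₀)| + 1) := by
    rw [hM, div_neg, mul_neg, mul_div_cancel₀ _ hA.ne]
  -- Slack below `δ` together with `P² > p₀² / 2` forces curvature at least `M`.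
  set δ := R * p₀ ^ 2 / (2 * M) with hδ
  have hp2 : 0 < p₀ ^ 2 := sq_pos_of_neg hp0
  have hδ0 : 0 < δ := by positivity
  have hev1 : ∀ᶠ w in 𝓝[>] w₀, slack lam r c v (P w) w < δ :=
    (hDc.tendsto.mono_left hne).eventually (gt_mem_nhds (hle.trans_lt hδ0))
  have hPc : Tendsto P (𝓝[>] w₀) (𝓝 p₀) := (hP w₀ hself).tendsto.mono_left hne
  have hev2 : ∀ᶠ w in 𝓝[>] w₀, p₀ ^ 2 / 2 < P w ^ 2 :=
    (hPc.pow 2).eventually (lt_mem_nhds (by linarith))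
  obtain ⟨y, hy, hsub⟩ := (mem_nhdsGT_iff_exists_Ioo_subset' hw₀.2).1
    (inter_mem (inter_mem hev1 hev2) (Ioo_mem_nhdsGT hw₀.2))
  have hy' : w₀ < y := hy
  have hq : ∀ w ∈ Ioo w₀ y, ∀ p q, TouchedAbove v w p q → M ≤ q := by
    intro w hw p q hT
    obtain ⟨⟨h1, h2⟩, h3⟩ := hsub hw
    simp only [mem_ofPred_eq] at h1 h2
    have hpe := hT.eq_of_hasDerivAt (hPd w h3)
    obtain ⟨a1, a2, a3⟩ := h.above w (hsubO h3) p q hT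
    rw [hpe] at a2 a3
    have b1 : R * (p₀ ^ 2 / 2) < q * δ :=
      (mul_lt_mul_of_pos_left h2 hR).trans_le
        (a3.trans (mul_le_mul_of_nonneg_left h1.le a1))
    have b2 : R * (p₀ ^ 2 / 2) = M * δ := by rw [hδ]; field_simp
    rw [b2] at b1
    exact (lt_of_mul_lt_mul_right b1 hδ0.le).le
  have hgrow : ∀ w ∈ Ioo w₀ y, M * (w - w₀) ≤ P w - p₀ := by
    intro w hw
    have hlim1 : Tendsto (fun z => M * (w - z)) (𝓝[>] w₀) (𝓝 (M * (w - w₀))) := by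
      have : ContinuousAt (fun z => M * (w - z)) w₀ := by fun_prop
      exact this.tendsto.mono_left nhdsWithin_le_nhds
    refine le_of_tendsto_of_tendsto hlim1 (hPc.const_sub (P w)) ?_
    filter_upwards [Ioo_mem_nhdsGT hw.1] with z hz
    exact deriv_sub_ge_of_touchedAbove (fun w hw => hPd w (hsub hw).2) hq
      ⟨hz.1, hz.2.trans hw.2⟩ hw hz.2.le
  have hvd : HasDerivWithinAt v p₀ (Ioi w₀) w₀ := by
    refine (hasDerivWithinAt_Ici_of_tendsto_deriv (s := Ioo w₀ s)
      (fun w hw => (hPd w hw).differentiableAt.differentiableWithinAt)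
      ((h.continuousOn w₀ (hsubI hself)).mono (Ioo_subset_Ico_self.trans hsubI))
      (Ioo_mem_nhdsGT hw₀.2) (hPc.congr' ?_)).mono Ioi_subset_Ici_self
    filter_upwards [Ioo_mem_nhdsGT hw₀.2] with w hw using hd w hw
  have hvne : v w₀ ≠ 0 := by linarith
  -- Replacing `P` by its minorant `p₀ + M (w - w₀)` bounds the slack from above, as the drift is
  -- negative. This bound is at most 0 at `w₀` and nonnegative to the right, yet its right
  -- derivative is at most -1.
  have hk : HasDerivWithinAt (fun w => (r * w - c) * (p₀ + M * (w - w₀))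
      - lam * (v w * Real.log (v w)))
      (r * p₀ + (r * w₀ - c) * M - lam * ((Real.log (v w₀) + 1) * p₀)) (Ioi w₀) w₀ := by
    have e1 : HasDerivAt (fun w : ℝ => r * w - c) r w₀ := by
      simpa using ((hasDerivAt_id w₀).const_mul r).sub_const c
    have e2 : HasDerivAt (fun w : ℝ => p₀ + M * (w - w₀)) M w₀ := by
      simpa using (((hasDerivAt_id w₀).sub_const w₀).const_mul M).const_add p₀
    refine ((e1.mul e2).hasDerivWithinAt.sub
      ((hvd.mul (hvd.log hvne)).const_mul lam)).congr_deriv ?_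
    field_simp
    ring
  rw [hasDerivWithinAt_iff_tendsto_slope' (by simp)] at hk
  have hk0 : 0 ≤ r * p₀ + (r * w₀ - c) * M - lam * ((Real.log (v w₀) + 1) * p₀) := by
    refine ge_of_tendsto hk ?_
    filter_upwards [Ioo_mem_nhdsGT hy'] with w hw
    have hws := (hsub hw).2
    rw [slope_def_field]
    refine div_nonneg ?_ (sub_nonneg.2 hw.1.le)
    have g1 := hgrow w hw
    have g2 := h.slack_nonneg (hsubO hws)
    rw [← hd w hws] at g2
    have g3 := h.drift_neg w ⟨(hsubO hws).1.le, hws.2⟩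
    have g4 := mul_le_mul_of_nonpos_left (show p₀ + M * (w - w₀) ≤ P w by linarith) g3.le
    simp only [slack] at g2 hle
    simp only [sub_self, mul_zero, add_zero]
    linarith
  rw [hMA] at hk0
  linarith [le_abs_self (r * p₀ - lam * ((Real.log (v w₀) + 1) * p₀))]

theorem slack_deriv_pos (h : IsParabolaSolution R lam r c b s v) {w : ℝ} (hw : w ∈ Ioo b s)
    (hv : 1 < v w) : 0 < slack lam r c v (deriv v w) w :=
  h.slack_pos ⟨hw.1.le, hw.2⟩
    (h.continuousOn_deriv.mono fun _ hz => ⟨hw.1.trans_le hz.1, hz.2⟩) (fun _ _ => rfl) hv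

theorem deriv_neg (h : IsParabolaSolution R lam r c b s v) {w : ℝ} (hw : w ∈ Ioo b s)
    (hv : 1 < v w) : deriv v w < 0 := by
  have h1 := h.slack_deriv_pos hw hv
  have h2 := h.drift_neg w ⟨hw.1.le, hw.2⟩
  have h3 := mul_nonneg h.lam_pos.le (h.mul_log_nonneg (Ioo_subset_Icc_self hw))
  simp only [slack] at h1
  by_contra! hcon
  nlinarith

/-- By continuity of `g = R v'² / D`, near `w₀` parabolas from above have curvature at least `g w₀ -
η` and those from below at most `g w₀ + η`. This traps the increments of `v'`. -/
theorem hasDerivAt_deriv (h : IsParabolaSolution R lam r c b s v) {w₀ : ℝ} (hw₀ : w₀ ∈ Ioo b s)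
    (hv : 1 < v w₀) :
    HasDerivAt (deriv v) (R * deriv v w₀ ^ 2 / slack lam r c v (deriv v w₀) w₀) w₀ := by
  have hnhds := Ioo_mem_nhds hw₀.1 hw₀.2
  have hPc : ContinuousAt (deriv v) w₀ := h.continuousOn_deriv.continuousAt hnhds
  have hDc : ContinuousAt (fun w => slack lam r c v (deriv v w) w) w₀ :=
    (h.continuousOn_slack Ioo_subset_Icc_self h.continuousOn_deriv).continuousAt hnhds
  have hD0 := h.slack_deriv_pos hw₀ hv
  have hR := h.R_pos
  set g : ℝ → ℝ := fun w => R * deriv v w ^ 2 / slack lam r c v (deriv v w) w with hg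
  have hgc : ContinuousAt g w₀ := ((hPc.pow 2).const_mul R).div hDc hD0.ne'
  rw [hasDerivAt_iff_isLittleO, Asymptotics.isLittleO_iff]
  intro η hη
  have hev : ∀ᶠ w in 𝓝 w₀, w ∈ Ioo b s ∧ 0 < slack lam r c v (deriv v w) w ∧
      g w₀ - η < g w ∧ g w < g w₀ + η := by
    filter_upwards [hnhds, hDc.eventually (lt_mem_nhds hD0),
      hgc.eventually (lt_mem_nhds (sub_lt_self _ hη)),
      hgc.eventually (gt_mem_nhds (lt_add_of_pos_right _ hη))] with w a1 a2 a3 a4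
    exact ⟨a1, a2, a3, a4⟩
  obtain ⟨x, y, hxy, hsub⟩ := mem_nhds_iff_exists_Ioo_subset.1 hev
  have hd : ∀ w ∈ Ioo x y, HasDerivAt v (deriv v w) w := fun w hw => h.hasDerivAt w (hsub hw).1
  have hlow : ∀ w ∈ Ioo x y, ∀ p q, TouchedAbove v w p q → g w₀ - η ≤ q := by
    intro w hw p q hT
    obtain ⟨a1, a2, a3, a4⟩ := hsub hw
    rw [hT.eq_of_hasDerivAt (hd w hw)] at hT
    exact a3.le.trans ((div_le_iff₀ a2).2 (h.above w a1 _ q hT).2.2)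
  have hup : ∀ w ∈ Ioo x y, ∀ p q, TouchedBelow v w p q → q ≤ g w₀ + η := by
    intro w hw p q hT
    obtain ⟨a1, a2, a3, a4⟩ := hsub hw
    rw [hT.eq_of_hasDerivAt (hd w hw)] at hT
    refine le_trans ?_ a4.le
    rcases le_or_gt q 0 with hq | hq
    · exact hq.trans (by positivity)
    · exact (le_div_iff₀ a2).2 (h.below w a1 _ q hT hq)
  filter_upwards [Ioo_mem_nhds hxy.1 hxy.2] with w hw
  rw [smul_eq_mul, Real.norm_eq_abs, Real.norm_eq_abs]
  change |deriv v w - deriv v w₀ - (w - w₀) * g w₀| ≤ η * |w - w₀|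
  rcases le_total w₀ w with hle | hle
  · have h1 := deriv_sub_ge_of_touchedAbove hd hlow hxy hw hle
    have h2 := deriv_sub_le_of_touchedBelow hd hup hxy hw hle
    rw [abs_of_nonneg (sub_nonneg.2 hle), abs_le]
    constructor <;> linarith
  · have h1 := deriv_sub_ge_of_touchedAbove hd hlow hw hxy hle
    have h2 := deriv_sub_le_of_touchedBelow hd hup hw hxy hle
    rw [abs_of_nonpos (sub_nonpos.2 hle), abs_le]
    constructor <;> linarith

/-- At the first point `w₁` with `v = 1` the derivative vanishes. Just to its left the slack is at
least a multiple of `-v'`, so `v'' ≤ -K v'`, and a negative `v'` cannot reach 0. -/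
theorem one_lt (h : IsParabolaSolution R lam r c b s v) {w : ℝ} (hw : w ∈ Ico b s) : 1 < v w := by
  by_contra! hle
  set Z := Icc b s ∩ v ⁻¹' {1} with hZ
  have hZc : IsCompact Z := by
    refine isCompact_Icc.of_isClosed_subset ?_ inter_subset_left
    exact h.continuousOn.preimage_isClosed_of_isClosed isClosed_Icc isClosed_singleton
  have hwI : w ∈ Icc b s := Ico_subset_Icc_self hw
  have hwZ : w ∈ Z := ⟨hwI, le_antisymm hle (h.one_le w hwI)⟩
  obtain ⟨w₁, ⟨hw₁, hv₁⟩, hleast⟩ := hZc.exists_isLeast ⟨w, hwZ⟩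
  have hv₁ : v w₁ = 1 := hv₁
  have hlt : w₁ < s := (hleast hwZ).trans_lt hw.2
  have hbw : b < w₁ := by
    refine lt_of_le_of_ne hw₁.1 ?_
    rintro rfl
    exact h.one_lt_left.ne' hv₁
  have hmem : w₁ ∈ Ioo b s := ⟨hbw, hlt⟩
  have hgt : ∀ z ∈ Ioo b w₁, 1 < v z := by
    intro z hz
    have hzI : z ∈ Icc b s := ⟨hz.1.le, (hz.2.trans hlt).le⟩
    refine lt_of_le_of_ne (h.one_le z hzI) fun he => ?_
    exact absurd (hleast ⟨hzI, he.symm⟩) (not_le.2 hz.2)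
  have hd0 : deriv v w₁ = 0 := by
    have : IsLocalMin v w₁ := by
      filter_upwards [Icc_mem_nhds hbw hlt] with z hz
      rw [hv₁]; exact h.one_le z hz
    exact this.deriv_eq_zero
  have hA := h.drift_neg w₁ ⟨hbw.le, hlt⟩
  have hlam := h.lam_pos
  have hR := h.R_pos
  have hVb : 0 < v b := zero_lt_one.trans h.one_lt_left
  -- With `A = -(r w₁ - c)`, the drift contributes at least `3A/4` times `-v'` and the logarithmic
  -- term costs at most `A/4` times `-v'`, leaving slack at least `A/2` times `-v'`.
  have hev : ∀ᶠ z in 𝓝[<] w₁, lam * v b * (w₁ - z) < -(r * w₁ - c) / 4 ∧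
      r * z - c < (r * w₁ - c) * (3 / 4) := by
    have c1 : ContinuousAt (fun z => lam * v b * (w₁ - z)) w₁ := by fun_prop
    have c2 : ContinuousAt (fun z => r * z - c) w₁ := by fun_prop
    exact nhdsWithin_le_nhds ((c1.eventually
      (gt_mem_nhds (by simp only [sub_self, mul_zero]; linarith))).and
        (c2.eventually (gt_mem_nhds (by linarith))))
  obtain ⟨y, hy, hsub⟩ := (mem_nhdsLT_iff_exists_Ioo_subset' hbw).1
    (inter_mem hev (Ioo_mem_nhdsLT hbw))
  have hy' : y < w₁ := hy
  set w₂ := (y + w₁) / 2 with hw₂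
  have hIoc : Icc w₂ w₁ ⊆ Ioc y w₁ := fun z hz => ⟨by linarith [hz.1], hz.2⟩
  have hIoo : Ioo w₂ w₁ ⊆ Ioo y w₁ := fun z hz => ⟨by linarith [hz.1], hz.2⟩
  have hIb : ∀ z ∈ Ioo y w₁, z ∈ Ioo b w₁ := fun z hz => (hsub hz).2
  have hw₂m : w₂ ∈ Ioo y w₁ := ⟨by linarith, by linarith⟩
  have hanti := antitoneOn_mul_exp (P := deriv v)
    (P' := fun z => R * deriv v z ^ 2 / slack lam r c v (deriv v z) z)
    (K := 2 * R / (-(r * w₁ - c))) (s := Icc w₂ w₁) (convex_Icc _ _)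
    (h.continuousOn_deriv.mono fun z hz =>
      ⟨(hIb w₂ hw₂m).1.trans_le hz.1, hz.2.trans_lt hlt⟩)
    (fun z hz => by
      rw [interior_Icc] at hz
      have hzb := hIb z (hIoo hz)
      exact h.hasDerivAt_deriv ⟨hzb.1, hzb.2.trans hlt⟩ (hgt z hzb))
    (fun z hz => by
      rw [interior_Icc] at hz
      obtain ⟨⟨e1, e2⟩, hzb⟩ := hsub (hIoo hz)
      have hzI : z ∈ Ioo b s := ⟨hzb.1, hzb.2.trans hlt⟩
      have hneg := h.deriv_neg hzI (hgt z hzb)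
      have hD := h.slack_deriv_pos hzI (hgt z hzb)
      have t1 := h.tangent_le hzI (Ioo_subset_Icc_self hmem)
      rw [hv₁] at t1
      have t2 := h.mul_log_le (Ioo_subset_Icc_self hzI)
      have t3 : lam * (v z * Real.log (v z)) ≤ lam * v b * (w₁ - z) * (-deriv v z) := by
        have : lam * (v z * Real.log (v z)) ≤ lam * (v b * (v z - 1)) :=
          mul_le_mul_of_nonneg_left t2 hlam.le
        have : lam * v b * (v z - 1) ≤ lam * v b * (-(deriv v z * (w₁ - z))) :=
          mul_le_mul_of_nonneg_left (by linarith) (by positivity)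
        linarith
      have t4 : -(r * w₁ - c) / 2 * (-deriv v z) ≤ slack lam r c v (deriv v z) z := by
        have u1 := mul_le_mul_of_nonneg_right e1.le (neg_nonneg.2 hneg.le)
        have u2 := mul_le_mul_of_nonneg_right e2.le (neg_nonneg.2 hneg.le)
        simp only [slack]
        linarith
      rw [div_le_iff₀ hD]
      have hA' : 0 < -(r * w₁ - c) := by linarith
      calc R * deriv v z ^ 2 = -(2 * R / -(r * w₁ - c)) * deriv v z *
            (-(r * w₁ - c) / 2 * (-deriv v z)) := by
              generalize -(r * w₁ - c) = a at hA'
              field_simp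
        _ ≤ _ := by
          refine mul_le_mul_of_nonneg_left t4 ?_
          have : 0 ≤ 2 * R / -(r * w₁ - c) := by positivity
          nlinarith)
  have h1 := hanti (left_mem_Icc.2 hw₂m.2.le) (right_mem_Icc.2 hw₂m.2.le) hw₂m.2.le
  have hw₂b := hIb w₂ hw₂m
  have h2 := h.deriv_neg ⟨hw₂b.1, hw₂b.2.trans hlt⟩ (hgt w₂ hw₂b)
  simp only [hd0, zero_mul] at h1
  exact absurd h1 (not_le.2 (mul_neg_of_neg_of_pos h2 (Real.exp_pos _)))

/-- This makes the one-sided derivative at `b` finite. Where `v'` is very negative, the drift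
dominates the logarithmic term, so `v'' ≤ -K v'` and `-v'` grows at most exponentially towards `b`.
-/
theorem bddBelow_deriv (h : IsParabolaSolution R lam r c b s v) :
    BddBelow (deriv v '' Ioo b s) := by
  set m := (b + s) / 2 with hm
  have hbs := h.lt
  have hmI : m ∈ Ioo b s := ⟨by linarith, by linarith⟩
  have hA := h.drift_neg m ⟨hmI.1.le, hmI.2⟩
  have hr := h.drift_neg b ⟨le_rfl, hbs⟩
  have hR := h.R_pos
  have hlam := h.lam_pos
  have hVb : 0 < v b := zero_lt_one.trans h.one_lt_left
  -- The drift may vanish at `s`, so a uniform bound is taken on `[b, m]` only; being affine, it is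
  -- largest at an endpoint.
  obtain ⟨a, ha, haw⟩ : ∃ a > 0, ∀ w ∈ Icc b m, r * w - c ≤ -a := by
    refine ⟨min (-(r * m - c)) (-(r * b - c)), lt_min (by linarith) (by linarith), ?_⟩
    intro w hw
    rcases le_total 0 r with h0 | h0
    · linarith [min_le_left (-(r * m - c)) (-(r * b - c)), mul_le_mul_of_nonneg_left hw.2 h0]
    · linarith [min_le_right (-(r * m - c)) (-(r * b - c)), mul_le_mul_of_nonpos_left hw.1 h0]
  set H := lam * (v b * v b) with hH
  have hHpos : 0 < H := by positivity
  by_cases hall : ∀ w ∈ Ioo b s, -(2 * H / a) ≤ deriv v w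
  · exact ⟨_, by rintro _ ⟨w, hw, rfl⟩; exact hall w hw⟩
  push Not at hall
  obtain ⟨w', hw', hlt'⟩ := hall
  set w₂ := min w' m with hw₂
  have hw₂I : w₂ ∈ Ioo b s := ⟨lt_min hw'.1 hmI.1, (min_le_left _ _).trans_lt hw'.2⟩
  have hlt : deriv v w₂ < -(2 * H / a) :=
    (h.monotoneOn_deriv hw₂I hw' (min_le_left _ _)).trans_lt hlt'
  have hsub : Ioc b w₂ ⊆ Ioo b s := fun z hz => ⟨hz.1, hz.2.trans_lt hw₂I.2⟩
  have hanti := antitoneOn_mul_exp (P := deriv v)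
    (P' := fun z => R * deriv v z ^ 2 / slack lam r c v (deriv v z) z)
    (K := 2 * R / a) (s := Ioc b w₂) (convex_Ioc _ _)
    (h.continuousOn_deriv.mono hsub)
    (fun z hz => by
      have hzI := hsub (interior_subset hz)
      exact h.hasDerivAt_deriv hzI (h.one_lt ⟨hzI.1.le, hzI.2⟩))
    (fun z hz => by
      have hz' := interior_subset hz
      have hzI := hsub hz'
      have hv1 := h.one_lt ⟨hzI.1.le, hzI.2⟩
      have hneg := h.deriv_neg hzI hv1
      have hD := h.slack_deriv_pos hzI hv1
      have t1 : deriv v z < -(2 * H / a) := (h.monotoneOn_deriv hzI hw₂I hz'.2).trans_lt hlt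
      have t2 : H ≤ a / 2 * (-deriv v z) := by
        have : a / 2 * (2 * H / a) = H := by field_simp
        nlinarith
      have t3 : lam * (v z * Real.log (v z)) ≤ H := by
        refine mul_le_mul_of_nonneg_left ((h.mul_log_le (Ioo_subset_Icc_self hzI)).trans ?_) hlam.le
        exact mul_le_mul_of_nonneg_left
          (by linarith [h.le_left (Ioo_subset_Icc_self hzI)]) hVb.le
      have t4 : a / 2 * (-deriv v z) ≤ slack lam r c v (deriv v z) z := by
        have := mul_le_mul_of_nonpos_right (haw z ⟨hzI.1.le, hz'.2.trans (min_le_right _ _)⟩)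
          hneg.le
        simp only [slack]
        linarith
      rw [div_le_iff₀ hD]
      calc R * deriv v z ^ 2 = -(2 * R / a) * deriv v z * (a / 2 * (-deriv v z)) := by
            field_simp
        _ ≤ _ := by
          refine mul_le_mul_of_nonneg_left t4 ?_
          have : 0 ≤ 2 * R / a := by positivity
          nlinarith)
  set K := 2 * R / a with hK
  have hK0 : 0 ≤ K := by positivity
  have hw₂neg : deriv v w₂ < 0 := hlt.trans (by have : 0 < 2 * H / a := by positivity
                                                linarith)
  have hbound : ∀ z ∈ Ioc b w₂, deriv v w₂ * Real.exp (K * (w₂ - b)) ≤ deriv v z := by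
    intro z hz
    have e := hanti hz (right_mem_Ioc.2 hw₂I.1) hz.2
    simp only at e
    have e1 : deriv v w₂ * Real.exp (K * w₂) = deriv v w₂ * Real.exp (K * (w₂ - z)) *
        Real.exp (K * z) := by
      rw [mul_assoc, ← Real.exp_add]; ring_nf
    rw [e1] at e
    have e2 := le_of_mul_le_mul_right e (Real.exp_pos _)
    refine le_trans ?_ e2
    refine mul_le_mul_of_nonpos_left (Real.exp_le_exp.2 ?_) hw₂neg.le
    exact mul_le_mul_of_nonneg_left (by linarith [hz.1]) hK0
  refine ⟨deriv v w₂ * Real.exp (K * (w₂ - b)), ?_⟩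
  rintro _ ⟨z, hz, rfl⟩
  rcases le_total z w₂ with hle | hle
  · exact hbound z ⟨hz.1, hle⟩
  · exact (hbound w₂ (right_mem_Ioc.2 hw₂I.1)).trans (h.monotoneOn_deriv hw₂I hz hle)

end IsParabolaSolution

/-! ### Derivatives on a half-open interval -/

section Ico

variable {b s : ℝ} {f f₁ f₂ : ℝ → ℝ}

theorem iteratedDerivWithin_two_Ico (h₁ : ∀ w ∈ Ico b s, HasDerivWithinAt f (f₁ w) (Ico b s) w)
    (h₂ : ∀ w ∈ Ico b s, HasDerivWithinAt f₁ (f₂ w) (Ico b s) w) {w : ℝ} (hw : w ∈ Ico b s) :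
    iteratedDerivWithin 2 f (Ico b s) w = f₂ w := by
  have hU := uniqueDiffOn_Ico b s
  rw [show (2 : ℕ) = 1 + 1 from rfl, iteratedDerivWithin_succ, ← (h₂ w hw).derivWithin (hU w hw)]
  refine derivWithin_congr (fun z hz => ?_) ?_
  · rw [iteratedDerivWithin_one, (h₁ z hz).derivWithin (hU z hz)]
  · rw [iteratedDerivWithin_one, (h₁ w hw).derivWithin (hU w hw)]

theorem hasDerivAt_of_Ico (h₁ : ∀ w ∈ Ico b s, HasDerivWithinAt f (f₁ w) (Ico b s) w) {w : ℝ}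
    (hw : w ∈ Ioo b s) : HasDerivAt f (f₁ w) w :=
  (h₁ w (Ioo_subset_Ico_self hw)).hasDerivAt (Ico_mem_nhds hw.1 hw.2)

theorem deriv_deriv_of_Ico (h₁ : ∀ w ∈ Ico b s, HasDerivWithinAt f (f₁ w) (Ico b s) w)
    (h₂ : ∀ w ∈ Ico b s, HasDerivWithinAt f₁ (f₂ w) (Ico b s) w) {w : ℝ} (hw : w ∈ Ioo b s) :
    deriv (deriv f) w = f₂ w := by
  rw [← (hasDerivAt_of_Ico h₂ hw).deriv]
  refine EventuallyEq.deriv_eq ?_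
  filter_upwards [Ioo_mem_nhds hw.1 hw.2] with z hz using (hasDerivAt_of_Ico h₁ hz).deriv

end Ico

theorem contDiffOn_succ_of_hasDerivWithinAt {f f₁ : ℝ → ℝ} {t : Set ℝ} (ht : UniqueDiffOn ℝ t)
    (h : ∀ w ∈ t, HasDerivWithinAt f (f₁ w) t w) {n : ℕ} (hf₁ : ContDiffOn ℝ n f₁ t) :
    ContDiffOn ℝ (n + 1) f t :=
  (contDiffOn_succ_iff_derivWithin ht).2 ⟨fun w hw => (h w hw).differentiableWithinAt,
    fun hn => absurd hn (by simp), hf₁.congr fun w hw => (h w hw).derivWithin (ht w hw)⟩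

/-! ### Classical regularity up to the boundary -/

namespace IsParabolaSolution

variable {R lam r c b s : ℝ} {v : ℝ → ℝ}

/-- The derivative is monotone and bounded, so it has limits at both ends, and these are the
one-sided derivatives. -/
theorem exists_continuousOn_derivative (h : IsParabolaSolution R lam r c b s v) :
    ∃ P : ℝ → ℝ, ContinuousOn P (Icc b s) ∧ (∀ w ∈ Ioo b s, P w = deriv v w) ∧
      ∀ w ∈ Icc b s, HasDerivWithinAt v (P w) (Icc b s) w := by
  have hne : (Ioo b s).Nonempty := nonempty_Ioo.2 h.lt
  have hbd : BddAbove (deriv v '' Ioo b s) :=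
    ⟨0, by rintro _ ⟨w, hw, rfl⟩; exact (h.deriv_neg hw (h.one_lt ⟨hw.1.le, hw.2⟩)).le⟩
  have hL := h.monotoneOn_deriv.tendsto_nhdsWithin_Ioo_right hne h.bddBelow_deriv
  have hRt := h.monotoneOn_deriv.tendsto_nhdsWithin_Ioo_left hne hbd
  have hdiff : DifferentiableOn ℝ v (Ioo b s) :=
    fun w hw => (h.differentiableAt hw).differentiableWithinAt
  refine ⟨extendFrom (Ioo b s) (deriv v), continuousOn_Icc_extendFrom_Ioo h.continuousOn_deriv
    hL hRt, extendFrom_extends h.continuousOn_deriv, fun w hw => ?_⟩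
  rcases hw.1.eq_or_lt with rfl | hbw
  · rw [eq_lim_at_left_extendFrom_Ioo h.lt hL]
    exact (hasDerivWithinAt_Ici_of_tendsto_deriv hdiff
      ((h.continuousOn b hw).mono Ioo_subset_Icc_self) (Ioo_mem_nhdsGT h.lt) hL).mono
      Icc_subset_Ici_self
  rcases hw.2.eq_or_lt with rfl | hws
  · rw [eq_lim_at_right_extendFrom_Ioo h.lt hRt]
    exact (hasDerivWithinAt_Iic_of_tendsto_deriv hdiff
      ((h.continuousOn w hw).mono Ioo_subset_Icc_self) (Ioo_mem_nhdsLT h.lt) hRt).mono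
      Icc_subset_Iic_self
  · rw [extendFrom_extends h.continuousOn_deriv w ⟨hbw, hws⟩]
    exact (h.hasDerivAt w ⟨hbw, hws⟩).hasDerivWithinAt

/-- At `b` the right side of `P' = R P² / D` is continuous because `slack_pos` applies there too, so
the equation extends by a limit. The right end is left out: at `s = c / r` the slack vanishes. -/
theorem classical (h : IsParabolaSolution R lam r c b s v) :
    ∃ P : ℝ → ℝ, ContinuousOn P (Icc b s) ∧
      (∀ w ∈ Icc b s, HasDerivWithinAt v (P w) (Icc b s) w) ∧
      ∀ w ∈ Ico b s, P w < 0 ∧ 0 < slack lam r c v (P w) w ∧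
        HasDerivWithinAt P (R * P w ^ 2 / slack lam r c v (P w) w) (Ico b s) w := by
  obtain ⟨P, hPc, hPd, hv⟩ := h.exists_continuousOn_derivative
  refine ⟨P, hPc, hv, fun w hw => ?_⟩
  have hD : ∀ w ∈ Ico b s, 0 < slack lam r c v (P w) w := fun w hw =>
    h.slack_pos hw (hPc.mono fun z hz => ⟨hw.1.trans hz.1, hz.2.le⟩)
      (fun z hz => hPd z ⟨hw.1.trans_lt hz.1, hz.2⟩) (h.one_lt hw)
  have hneg : P w < 0 := by
    have h1 := hD w hw
    have h2 := h.drift_neg w hw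
    have h3 := mul_nonneg h.lam_pos.le (h.mul_log_nonneg (Ico_subset_Icc_self hw))
    simp only [slack] at h1
    by_contra! hcon
    nlinarith
  refine ⟨hneg, hD w hw, ?_⟩
  have hint : ∀ z ∈ Ioo b s, HasDerivAt P (R * P z ^ 2 / slack lam r c v (P z) z) z := by
    intro z hz
    rw [hPd z hz]
    refine (h.hasDerivAt_deriv hz (h.one_lt ⟨hz.1.le, hz.2⟩)).congr_of_eventuallyEq ?_
    filter_upwards [Ioo_mem_nhds hz.1 hz.2] with y hy using hPd y hy
  rcases hw.1.eq_or_lt with rfl | hbw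
  · have hGc : ContinuousOn (fun z => R * P z ^ 2 / slack lam r c v (P z) z) (Ico b s) :=
      ((hPc.mono Ico_subset_Icc_self).pow 2 |>.const_mul R).div
        (h.continuousOn_slack Ico_subset_Icc_self (hPc.mono Ico_subset_Icc_self))
        fun z hz => (hD z hz).ne'
    have hlim : Tendsto (fun z => R * P z ^ 2 / slack lam r c v (P z) z) (𝓝[>] b)
        (𝓝 (R * P b ^ 2 / slack lam r c v (P b) b)) := by
      refine (hGc b hw).tendsto.mono_left ?_
      rw [← nhdsWithin_Ioo_eq_nhdsGT h.lt]
      exact nhdsWithin_mono _ Ioo_subset_Ico_self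
    refine (hasDerivWithinAt_Ici_of_tendsto_deriv (s := Ioo b s)
      (fun z hz => (hint z hz).differentiableAt.differentiableWithinAt)
      ((hPc b ⟨le_rfl, h.lt.le⟩).mono Ioo_subset_Icc_self) (Ioo_mem_nhdsGT h.lt)
      (hlim.congr' ?_)).mono Ico_subset_Ici_self
    filter_upwards [Ioo_mem_nhdsGT h.lt] with z hz using (hint z hz).deriv.symm
  · exact (hint w ⟨hbw, hw.2⟩).hasDerivWithinAt

/-- Bootstrap: `v' = P`, and `P'` is a smooth expression in `w`, `v`, `P` with nonvanishing
denominator, so each order of regularity yields the next. -/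
theorem contDiffOn_smooth (h : IsParabolaSolution R lam r c b s v) {P : ℝ → ℝ}
    (hv : ∀ w ∈ Ico b s, HasDerivWithinAt v (P w) (Ico b s) w)
    (hD : ∀ w ∈ Ico b s, 0 < slack lam r c v (P w) w)
    (hP : ∀ w ∈ Ico b s,
      HasDerivWithinAt P (R * P w ^ 2 / slack lam r c v (P w) w) (Ico b s) w) :
    ContDiffOn ℝ ∞ v (Ico b s) := by
  have hU := uniqueDiffOn_Ico b s
  have key : ∀ n : ℕ, ContDiffOn ℝ n v (Ico b s) ∧ ContDiffOn ℝ n P (Ico b s) := by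
    intro n
    induction n with
    | zero =>
      simp only [CharP.cast_eq_zero, contDiffOn_zero]
      exact ⟨fun w hw => (hv w hw).continuousWithinAt, fun w hw => (hP w hw).continuousWithinAt⟩
    | succ n ih =>
      obtain ⟨ihv, ihP⟩ := ih
      push_cast
      refine ⟨contDiffOn_succ_of_hasDerivWithinAt hU hv ihP,
        contDiffOn_succ_of_hasDerivWithinAt hU hP ?_⟩
      have hlog : ContDiffOn ℝ n (fun w => Real.log (v w)) (Ico b s) :=
        ihv.log fun w hw => (zero_lt_one.trans (h.one_lt hw)).ne'
      have hdrift : ContDiffOn ℝ n (fun w : ℝ => r * w - c) (Ico b s) := by fun_prop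
      have hsl : ContDiffOn ℝ n (fun w => slack lam r c v (P w) w) (Ico b s) :=
        (hdrift.mul ihP).sub (contDiffOn_const.mul (ihv.mul hlog))
      exact (contDiffOn_const.mul (ihP.pow 2)).div hsl fun w hw => (hD w hw).ne'
  exact contDiffOn_infty.2 fun n => (key n).1

end IsParabolaSolution

theorem proposition5p5 (r μ σ c lam ε b : ℝ)
    (hr : 0 < r) (hμ : r < μ) (hσ : 0 < σ) (hc : 0 < c) (hlam : 0 < lam) (hε : 0 < ε)
    (hb : b < c / r)
    (u : ℝ → ℝ) (hu : IsRobustRuinViscositySolution r μ σ c lam ε b u) :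
    -- the Cole-Hopf transform
    (StrictConvexOn ℝ (Icc b (c / r)) (coleHopf ε u) ∧
      StrictAntiOn (coleHopf ε u) (Icc b (c / r)) ∧
      ContDiffOn ℝ 1 (coleHopf ε u) (Icc b (c / r)) ∧
      ContDiffOn ℝ 2 (coleHopf ε u) (Ico b (c / r)) ∧
      ContDiffOn ℝ ∞ (coleHopf ε u) (Ico b (c / r)) ∧
      (∀ w ∈ Ico b (c / r),
        derivWithin (coleHopf ε u) (Ico b (c / r)) w < 0 ∧
        0 < iteratedDerivWithin 2 (coleHopf ε u) (Ico b (c / r)) w) ∧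
      (∀ w ∈ Ioo b (c / r),
        lam * coleHopf ε u w * Real.log (coleHopf ε u w) =
          -(sharpeConst r μ σ * deriv (coleHopf ε u) w ^ 2 / deriv (deriv (coleHopf ε u)) w)
            + (r * w - c) * deriv (coleHopf ε u) w)) ∧
    -- the viscosity solution itself
    (ContDiffOn ℝ 1 u (Icc b (c / r)) ∧
      ContDiffOn ℝ 2 u (Ico b (c / r)) ∧
      (∀ w ∈ Ico b (c / r),
        derivWithin u (Ico b (c / r)) w < 0 ∧
        0 < ε * derivWithin u (Ico b (c / r)) w ^ 2
              + iteratedDerivWithin 2 u (Ico b (c / r)) w) ∧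
      (∀ w ∈ Ioo b (c / r),
        lam * u w =
          -(sharpeConst r μ σ * deriv u w ^ 2 / (ε * deriv u w ^ 2 + deriv (deriv u) w))
            + (r * w - c) * deriv u w)) := by
  have h := hu.isParabolaSolution hr hμ hσ hlam hε hb
  obtain ⟨P, hPc, hvP, hP⟩ := h.classical
  set v := coleHopf ε u with hv
  set s := c / r
  set R := sharpeConst r μ σ
  have hR : 0 < R := h.R_pos
  set G : ℝ → ℝ := fun w => R * P w ^ 2 / slack lam r c v (P w) w with hG
  have hvpos : ∀ w, 0 < v w := fun w => Real.exp_pos _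
  have hUI := uniqueDiffOn_Icc hb
  have hU := uniqueDiffOn_Ico b s
  have hv1 : ∀ w ∈ Ico b s, HasDerivWithinAt v (P w) (Ico b s) w := fun w hw =>
    (hvP w (Ico_subset_Icc_self hw)).mono Ico_subset_Icc_self
  have hv2 : ∀ w ∈ Ico b s, HasDerivWithinAt P (G w) (Ico b s) w := fun w hw => (hP w hw).2.2
  have hGpos : ∀ w ∈ Ico b s, 0 < G w := fun w hw =>
    div_pos (mul_pos hR (sq_pos_of_neg (hP w hw).1)) (hP w hw).2.1
  have hode : ∀ w ∈ Ico b s,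
      lam * (v w * Real.log (v w)) = -(R * P w ^ 2 / G w) + (r * w - c) * P w := by
    intro w hw
    have h1 := (hP w hw).2.1.ne'
    have h2 := (hP w hw).1.ne
    have : R * P w ^ 2 / G w = slack lam r c v (P w) w := by
      simp only [hG]; field_simp
    rw [this, slack]; ring
  have hvsmooth : ContDiffOn ℝ ∞ v (Ico b s) :=
    h.contDiffOn_smooth hv1 (fun w hw => (hP w hw).2.1) hv2
  have hvC1 : ContDiffOn ℝ 1 v (Icc b s) :=
    (contDiffOn_one_iff_derivWithin hUI).2 ⟨fun w hw => (hvP w hw).differentiableWithinAt,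
      hPc.congr fun w hw => (hvP w hw).derivWithin (hUI w hw)⟩
  have hvC2 : ContDiffOn ℝ 2 v (Ico b s) := contDiffOn_infty.1 hvsmooth 2
  have hulog : u = fun w => Real.log (v w) / ε := funext fun w => eq_log_exp_mul_div hε
  have hu1 : ∀ w ∈ Ico b s, HasDerivWithinAt u (P w / v w / ε) (Ico b s) w := by
    intro w hw
    rw [hulog]
    exact ((hv1 w hw).log (hvpos w).ne').div_const ε
  have hu2 : ∀ w ∈ Ico b s, HasDerivWithinAt (fun w => P w / v w / ε)
      ((G w * v w - P w * P w) / v w ^ 2 / ε) (Ico b s) w := fun w hw =>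
    ((hv2 w hw).div (hv1 w hw) (hvpos w).ne').div_const ε
  -- The identity `ε u'² + u'' = v'' / (ε v)` carries both the sign condition and the equation from
  -- `v` back to `u`.
  have hcurv : ∀ w, ε * (P w / v w / ε) ^ 2 + (G w * v w - P w * P w) / v w ^ 2 / ε =
      G w / v w / ε := by
    intro w
    have := (hvpos w).ne'
    field_simp; ring
  refine ⟨⟨?_, ?_, hvC1, hvC2, hvsmooth, ?_, ?_⟩, ?_, ?_, ?_, ?_⟩
  · refine strictConvexOn_of_deriv2_pos (convex_Icc b s) h.continuousOn fun w hw => ?_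
    rw [interior_Icc] at hw
    change 0 < deriv (deriv v) w
    rw [deriv_deriv_of_Ico hv1 hv2 hw]
    exact hGpos w (Ioo_subset_Ico_self hw)
  · refine strictAntiOn_of_deriv_neg (convex_Icc b s) h.continuousOn fun w hw => ?_
    rw [interior_Icc] at hw
    rw [(hasDerivAt_of_Ico hv1 hw).deriv]
    exact (hP w (Ioo_subset_Ico_self hw)).1
  · intro w hw
    rw [(hv1 w hw).derivWithin (hU w hw), iteratedDerivWithin_two_Ico hv1 hv2 hw]
    exact ⟨(hP w hw).1, hGpos w hw⟩
  · intro w hw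
    rw [(hasDerivAt_of_Ico hv1 hw).deriv, deriv_deriv_of_Ico hv1 hv2 hw, mul_assoc]
    exact hode w (Ioo_subset_Ico_self hw)
  · rw [hulog]
    exact (hvC1.log fun w _ => (hvpos w).ne').div_const ε
  · rw [hulog]
    exact (hvC2.log fun w _ => (hvpos w).ne').div_const ε
  · intro w hw
    rw [(hu1 w hw).derivWithin (hU w hw), iteratedDerivWithin_two_Ico hu1 hu2 hw, hcurv]
    exact ⟨div_neg_of_neg_of_pos (div_neg_of_neg_of_pos (hP w hw).1 (hvpos w)) hε,
      div_pos (div_pos (hGpos w hw) (hvpos w)) hε⟩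
  · intro w hw
    have hw' := Ioo_subset_Ico_self hw
    rw [(hasDerivAt_of_Ico hu1 hw).deriv, deriv_deriv_of_Ico hu1 hu2 hw, hcurv]
    have hvw := (hvpos w).ne'
    have hGw := (hGpos w hw').ne'
    have hlogu : Real.log (v w) = ε * u w := by
      rw [hulog]; field_simp
    have := hode w hw'
    rw [hlogu] at this
    have h1 : lam * u w = lam * (v w * (ε * u w)) / (v w * ε) := by field_simp
    rw [h1, this]
    field_simp
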